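/- Let $X$ be a real random variable that is log-concave, i.e. $X$ has a probability density function $f_X$ with respect to Lebesgue measure on $\mathbb R$ such that $f_X((1-\lambda)x+\lambda y) \ge f_X(x)^{1-\lambda} f_X(y)^{\lambda}$ for all $x,y\in\mathbb R$ and $\lambda\in[0,1]$ ($X$ is not assumed to be symmetric). Let $h(X) = -\int_{\mathbb R} f_X(x)\log f_X(x)\,dx$ denote its differential entropy, with the convention $0\log 0=0$, and put $\|Z\|_p = (\mathbb E|Z|^p)^{1/p}$. Then the integral defining $h(X)$ converges absolutely, $\mathbb E|X|<\infty$, and for every real $p\ge 1$ the moment $\mathbb E|X-\mathbb E X|^p$ is finite and $$h(X) \ge \log\frac{2\,\|X-\mathbb E[X]\|_p}{\Gamma(p+1)^{1/p}}.$$ Moreover, for $p=2$ this bound can be sharpened to $$h(X)\ge \log\bigl(2\sqrt{\operatorname{Var} X}\bigr).$$ -/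

import Mathlib

open MeasureTheory ProbabilityTheory

/-- A function `f : E → [0, ∞)` on a real vector space is log-concave if
`f ((1 - t) x + t y) ≥ f x ^ (1 - t) * f y ^ t` for all `x`, `y` and all `t ∈ [0, 1]`. -/
def IsLogConcave {E : Type*} [AddCommGroup E] [Module ℝ E] (f : E → ℝ) : Prop :=
  (∀ x, 0 ≤ f x) ∧
    ∀ x y : E, ∀ t ∈ Set.Icc (0 : ℝ) 1,
      f x ^ (1 - t) * f y ^ t ≤ f ((1 - t) • x + t • y)

/-- A real random variable is log-concave if its law has a log-concave probability density
function with respect to Lebesgue measure. -/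
def IsLogConcaveRV {Ω : Type*} [MeasurableSpace Ω] (X : Ω → ℝ) (P : Measure Ω) : Prop :=
  AEMeasurable X P ∧
    ∃ f : ℝ → ℝ, Measurable f ∧ IsLogConcave f ∧
      P.map X = (volume : Measure ℝ).withDensity (fun x => ENNReal.ofReal (f x))

/-- The integrand `- f_X(x) log f_X(x)` of the differential entropy, where `f_X` is the
probability density function of `X` (with the convention `0 log 0 = 0`). -/
noncomputable def entropyIntegrand {Ω : Type*} [MeasurableSpace Ω] (X : Ω → ℝ) (P : Measure Ω)
    (x : ℝ) : ℝ :=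
  -((pdf X P volume x).toReal * Real.log (pdf X P volume x).toReal)

/-- The differential entropy `h(X) = - ∫ f_X(x) log f_X(x) dx` (natural logarithm). -/
noncomputable def differentialEntropy {Ω : Type*} [MeasurableSpace Ω] (X : Ω → ℝ)
    (P : Measure Ω) : ℝ :=
  ∫ x, entropyIntegrand X P x

/-- The `p`-norm `‖X‖_p = (E |X| ^ p) ^ (1 / p)` of a random variable. -/
noncomputable def momentNorm {Ω : Type*} [MeasurableSpace Ω] (p : ℝ) (X : Ω → ℝ)
    (P : Measure Ω) : ℝ :=
  (∫ ω, |X ω| ^ p ∂P) ^ (1 / p)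

/-! Let `Y` be an independent copy of `X`, with density `f`, and put `A = ∫ f²`. The difference `Y -
X` has density `g z = ∫ f x * f (x + z)`, which is even, satisfies `g 0 = A`, and is log-concave by
Prékopa–Leindler. This symmetrization is what removes any symmetry assumption on `X`.

Among such densities with a given value at `0`, the two-sided exponential has the largest moments:
`log g` is concave, so it crosses the affine exponent at most once on the half-line. Hence `E|Y -
X|^p ≤ Γ(p+1) / (2A)^p`.

Jensen gives `E|X - E X|^p ≤ E|Y - X|^p`, and Jensen for `log` gives `h(X) ≥ -log A`; eliminating
`A` yields the bound. For `p = 2` the identity `E|Y - X|² = 2 Var X` replaces the first use of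
Jensen and gains a factor `√2`. Convergence of all integrals comes from exponential decay of `f`. -/

/-! ### Exponential decay of integrable log-concave functions -/

theorem IsLogConcave.min_le {f : ℝ → ℝ} (hf : IsLogConcave f) (x y : ℝ) {t : ℝ}
    (ht : t ∈ Set.Icc (0 : ℝ) 1) : min (f x) (f y) ≤ f ((1 - t) * x + t * y) := by
  have hm : 0 ≤ min (f x) (f y) := le_min (hf.1 x) (hf.1 y)
  calc min (f x) (f y) = min (f x) (f y) ^ (1 - t) * min (f x) (f y) ^ t := by
        rw [← Real.rpow_add_of_nonneg hm (by linarith [ht.2]) ht.1]; simp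
    _ ≤ f x ^ (1 - t) * f y ^ t := by
        have h1 := ht.1
        have h2 : 0 ≤ 1 - t := by linarith [ht.2]
        gcongr
        · exact Real.rpow_nonneg (hf.1 x) _
        · exact min_le_left _ _
        · exact min_le_right _ _
    _ ≤ _ := hf.2 x y t ht

/-- On the segment `f` stays above its smaller endpoint value, so a rectangle fits under the graph.
This turns integrability into pointwise bounds. -/
theorem IsLogConcave.min_mul_sub_le_integral {f : ℝ → ℝ} (hf : IsLogConcave f)
    (hi : Integrable f) {x y : ℝ} (hxy : x ≤ y) : min (f x) (f y) * (y - x) ≤ ∫ z, f z := by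
  calc min (f x) (f y) * (y - x) = ∫ _ in Set.Icc x y, min (f x) (f y) := by
        simp [hxy, mul_comm]
    _ ≤ ∫ z in Set.Icc x y, f z := by
        refine setIntegral_mono_on (integrable_const _) hi.integrableOn measurableSet_Icc ?_
        intro z hz
        rcases hxy.eq_or_lt with h | h
        · have : z = x := le_antisymm (hz.2.trans h.ge) hz.1
          rw [this]; exact min_le_left _ _
        · have h0 : 0 < y - x := sub_pos.2 h
          have := hf.min_le x y (t := (z - x) / (y - x))
            ⟨div_nonneg (by linarith [hz.1]) h0.le, (div_le_one h0).2 (by linarith [hz.2])⟩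
          have e : (1 - (z - x) / (y - x)) * x + (z - x) / (y - x) * y = z := by
            field_simp; ring
          rwa [e] at this
    _ ≤ ∫ z, f z := setIntegral_le_integral hi (Filter.Eventually.of_forall hf.1)

theorem IsLogConcave.min_mul_abs_sub_le_integral {f : ℝ → ℝ} (hf : IsLogConcave f)
    (hi : Integrable f) (x y : ℝ) : min (f x) (f y) * |x - y| ≤ ∫ z, f z := by
  rcases le_total x y with h | h
  · rw [abs_of_nonpos (sub_nonpos.2 h), neg_sub]
    exact hf.min_mul_sub_le_integral hi h
  · rw [abs_of_nonneg (sub_nonneg.2 h), min_comm]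
    exact hf.min_mul_sub_le_integral hi h

theorem IsLogConcave.sqrt_mul_le {f : ℝ → ℝ} (hf : IsLogConcave f) (x y : ℝ) :
    √(f x * f y) ≤ f ((x + y) / 2) := by
  have := hf.2 x y (1 / 2) (by norm_num)
  rw [show (1 : ℝ) - 1 / 2 = 1 / 2 by norm_num, ← Real.mul_rpow (hf.1 x) (hf.1 y),
    ← Real.sqrt_eq_rpow] at this
  convert this using 2
  simp only [smul_eq_mul]; ring

theorem exists_ne_pos_of_integral_pos {f : ℝ → ℝ} (hf : ∀ x, 0 ≤ f x) (h : 0 < ∫ x, f x) :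
    ∃ a b, a ≠ b ∧ 0 < f a ∧ 0 < f b := by
  by_contra! hc
  have hsub : (Function.support f).Subsingleton := by
    intro a ha b hb
    by_contra hab
    exact absurd (hc a b hab ((hf a).lt_of_ne' ha)) (not_le.2 ((hf b).lt_of_ne' hb))
  have h0 : f =ᵐ[volume] 0 := by
    have : volume (Function.support f) = 0 := hsub.measure_zero volume
    exact measure_mono_null (fun x hx => hx) this
  rw [integral_congr_ae h0] at h
  simp at h

theorem IsLogConcave.exists_le {f : ℝ → ℝ} (hf : IsLogConcave f) (hi : Integrable f)
    (hpos : 0 < ∫ x, f x) : ∃ M, ∀ x, f x ≤ M := by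
  obtain ⟨a, b, hab, ha, hb⟩ := exists_ne_pos_of_integral_pos hf.1 hpos
  set I := ∫ x, f x
  set s := min (f a) (f b)
  have hs : 0 < s := lt_min ha hb
  set d := |a - b|
  have hd : 0 < d := abs_pos.2 (sub_ne_zero.2 hab)
  refine ⟨max s ((4 * I / d) ^ 2 / s), fun x => ?_⟩
  rcases le_total (f x) s with h | h
  · exact h.trans (le_max_left _ _)
  refine le_trans ?_ (le_max_right _ _)
  -- One of `a`, `b` is at distance at least `d / 2` from `x`. A large `f x` forces `f` to be at
  -- least `√(s * f x)` at the midpoint of `x` and `y`, and the rectangle between `x` and that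
  -- midpoint then bounds `f x`.
  obtain ⟨y, hy, hxy⟩ : ∃ y, s ≤ f y ∧ d / 2 ≤ |x - y| := by
    by_contra! hc
    have h1 := hc a (min_le_left _ _)
    have h2 := hc b (min_le_right _ _)
    have : d ≤ |x - a| + |x - b| := by
      rw [abs_sub_comm x a]
      exact abs_sub_le a x b
    linarith
  have hm : √(s * f x) ≤ f ((x + y) / 2) := by
    refine le_trans (Real.sqrt_le_sqrt ?_) (hf.sqrt_mul_le x y)
    rw [mul_comm]; gcongr; exact hf.1 x
  have hm' : √(s * f x) ≤ f x := by
    rw [Real.sqrt_le_iff]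
    exact ⟨hf.1 x, by nlinarith [hf.1 x]⟩
  have key := hf.min_mul_abs_sub_le_integral hi x ((x + y) / 2)
  have e : |x - (x + y) / 2| = |x - y| / 2 := by
    rw [show x - (x + y) / 2 = (x - y) / 2 by ring, abs_div]; simp
  have h1 : √(s * f x) * (d / 4) ≤ I := by
    refine le_trans ?_ key
    rw [e]
    have hmin := le_min hm' hm
    exact mul_le_mul hmin (by linarith) (by positivity) ((Real.sqrt_nonneg _).trans hmin)
  have h2 : √(s * f x) ≤ 4 * I / d := by
    rw [le_div_iff₀ hd]; linarith
  rw [Real.sqrt_le_left (by positivity)] at h2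
  rw [le_div_iff₀ hs]; linarith

theorem IsLogConcave.exists_le_exp {f : ℝ → ℝ} (hf : IsLogConcave f) (hi : Integrable f)
    (hpos : 0 < ∫ x, f x) : ∃ C k, 0 < C ∧ 0 < k ∧ ∀ x, f x ≤ C * Real.exp (-(k * |x|)) := by
  obtain ⟨M, hM⟩ := hf.exists_le hi hpos
  obtain ⟨a, -, -, ha, -⟩ := exists_ne_pos_of_integral_pos hf.1 hpos
  set I := ∫ x, f x
  have hM0 : 0 < M := ha.trans_le (hM a)
  -- A rectangle of height `f a / 2` and width `2 * R` has area `2 * I`, which is too much. So `f`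
  -- has halved at distance `2 * R` from `a`, and `k` is the rate that halves over this length.
  set R := 2 * I / f a
  have hR : 0 < R := by positivity
  set k := Real.log 2 / (2 * R)
  have hk : 0 < k := div_pos (Real.log_pos one_lt_two) (by positivity)
  have main : ∀ x, f x ≤ 2 * M * Real.exp (-(k * |x - a|)) := by
    intro x
    rcases le_total |x - a| (2 * R) with h | h
    · have h1 : k * |x - a| ≤ Real.log 2 := by
        calc k * |x - a| ≤ k * (2 * R) := by gcongr
          _ = Real.log 2 := by simp only [k]; field_simp
      have h2 : Real.exp (-Real.log 2) ≤ Real.exp (-(k * |x - a|)) := by gcongr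
      rw [Real.exp_neg, Real.exp_log two_pos] at h2
      have := hM x
      nlinarith
    · have hxa : 0 < |x - a| := by linarith
      -- The point `a + t * (x - a)` lies at distance exactly `2 * R` from `a` towards `x`;
      -- log-concavity extrapolates the halving there out to `x`.
      set t := 2 * R / |x - a|
      have ht0 : 0 < t := by positivity
      have ht1 : t ≤ 1 := (div_le_one hxa).2 h
      have hfa : f (a + t * (x - a)) ≤ f a / 2 := by
        by_contra! hc
        have := hf.min_mul_abs_sub_le_integral hi (a + t * (x - a)) a
        have e : |a + t * (x - a) - a| = 2 * R := by
          rw [add_sub_cancel_left, abs_mul, abs_of_pos ht0]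
          simp only [t]; field_simp
        rw [e] at this
        have h3 : f a / 2 ≤ min (f (a + t * (x - a))) (f a) := le_min hc.le (by linarith)
        have h4 : f a / 2 * (2 * R) ≤ I := le_trans (by gcongr) this
        have h5 : f a / 2 * (2 * R) = 2 * I := by simp only [R]; field_simp
        linarith
      have h6 := hf.2 a x t ⟨ht0.le, ht1⟩
      rw [show (1 - t) • a + t • x = a + t * (x - a) by simp only [smul_eq_mul]; ring] at h6
      have h7 : f x ^ t ≤ (f a * Real.exp (-(k * |x - a|))) ^ t := by
        have h8 : 0 < f a ^ (1 - t) := Real.rpow_pos_of_pos ha _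
        rw [Real.mul_rpow ha.le (Real.exp_pos _).le, ← Real.exp_mul]
        have h9 : -(k * |x - a|) * t = -Real.log 2 := by
          simp only [t, k]; field_simp
        rw [h9, Real.exp_neg, Real.exp_log two_pos]
        have h10 : f a ^ (1 - t) * f a ^ t = f a := by
          rw [← Real.rpow_add ha]; simp
        refine le_of_mul_le_mul_left ?_ h8
        calc f a ^ (1 - t) * f x ^ t ≤ f a / 2 := h6.trans hfa
          _ = _ := by rw [← mul_assoc, h10]; ring
      have h8 := (Real.rpow_le_rpow_iff (hf.1 x) (by positivity) ht0).1 h7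
      refine h8.trans ?_
      gcongr
      linarith [hM a]
  refine ⟨2 * M * Real.exp (k * |a|), k, by positivity, hk, fun x => (main x).trans ?_⟩
  rw [mul_assoc _ (Real.exp _) (Real.exp _), ← Real.exp_add]
  gcongr
  have : |x| ≤ |x - a| + |a| := by simpa using abs_add_le (x - a) a
  nlinarith

/-! ### Integrability of moments, powers and `f log f` -/

theorem integrable_of_even_of_integrableOn_Ioi {F : ℝ → ℝ} (heven : ∀ x, F (-x) = F x)
    (h : IntegrableOn F (Set.Ioi 0)) : Integrable F := by
  rw [← integrableOn_univ, ← Set.Iio_union_Ici (a := (0 : ℝ)), integrableOn_union,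
    integrableOn_Ici_iff_integrableOn_Ioi]
  refine ⟨?_, h⟩
  rw [← (Measure.measurePreserving_neg (volume : Measure ℝ)).integrableOn_comp_preimage
      (Homeomorph.neg ℝ).measurableEmbedding]
  simpa [Function.comp_def, heven] using h

theorem integrable_abs_rpow_mul_exp_neg_mul_abs {p k : ℝ} (hp : 0 ≤ p) (hk : 0 < k) :
    Integrable fun x : ℝ => |x| ^ p * Real.exp (-(k * |x|)) := by
  refine integrable_of_even_of_integrableOn_Ioi (by simp) ?_
  refine (integrableOn_rpow_mul_exp_neg_mul_rpow (s := p) (p := 1) (b := k) (by linarith)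
    one_pos hk).congr_fun ?_ measurableSet_Ioi
  intro x hx
  simp only [Real.rpow_one, abs_of_pos (Set.mem_Ioi.1 hx), neg_mul]

theorem IsLogConcave.integrable_abs_rpow_mul {f : ℝ → ℝ} (hf : IsLogConcave f)
    (hi : Integrable f) (hpos : 0 < ∫ x, f x) {p : ℝ} (hp : 0 ≤ p) :
    Integrable fun x => |x| ^ p * f x := by
  obtain ⟨C, k, hC, hk, hle⟩ := hf.exists_le_exp hi hpos
  refine ((integrable_abs_rpow_mul_exp_neg_mul_abs hp hk).const_mul C).mono' ?_ ?_
  · exact (by fun_prop : AEStronglyMeasurable (fun x : ℝ => |x| ^ p) volume).mul hi.1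
  · refine Filter.Eventually.of_forall fun x => ?_
    have := Real.rpow_nonneg (abs_nonneg x) p
    rw [Real.norm_of_nonneg (mul_nonneg this (hf.1 x))]
    calc _ ≤ |x| ^ p * (C * Real.exp (-(k * |x|))) := by gcongr; exact hle x
      _ = _ := by ring

theorem IsLogConcave.integrable_rpow {f : ℝ → ℝ} (hf : IsLogConcave f)
    (hi : Integrable f) (hpos : 0 < ∫ x, f x) {q : ℝ} (hq : 0 < q) :
    Integrable fun x => f x ^ q := by
  obtain ⟨C, k, hC, hk, hle⟩ := hf.exists_le_exp hi hpos
  refine ((integrable_abs_rpow_mul_exp_neg_mul_abs le_rfl (mul_pos hk hq)).const_mul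
    (C ^ q)).mono' (hi.1.aemeasurable.pow_const q).aestronglyMeasurable ?_
  refine Filter.Eventually.of_forall fun x => ?_
  rw [Real.norm_of_nonneg (Real.rpow_nonneg (hf.1 x) q)]
  calc f x ^ q ≤ (C * Real.exp (-(k * |x|))) ^ q := Real.rpow_le_rpow (hf.1 x) (hle x) hq.le
    _ = _ := by
      rw [Real.mul_rpow hC.le (Real.exp_pos _).le, ← Real.exp_mul, Real.rpow_zero, one_mul]
      congr 2; ring

/-- Dominates `f log f` by powers of `f`, which are integrable. It follows from `log y ≤ y` and from
`1 - 1/√y ≤ log √y`. -/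
theorem abs_mul_log_le {y : ℝ} (hy : 0 ≤ y) :
    |y * Real.log y| ≤ 2 * y ^ (1 / 2 : ℝ) + y ^ (2 : ℝ) := by
  rcases hy.eq_or_lt with rfl | h0
  · simp
  have hs : 0 < √y := Real.sqrt_pos.2 h0
  rw [← Real.sqrt_eq_rpow, Real.rpow_two, abs_mul, abs_of_pos h0]
  have hlog : Real.log y = 2 * Real.log (√y) := by rw [Real.log_sqrt hy]; ring
  have h1 : Real.log y ≤ y := (Real.log_le_sub_one_of_pos h0).trans (by linarith)
  have h2 : -(2 / √y) ≤ Real.log y := by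
    have := Real.one_sub_inv_le_log_of_pos hs
    rw [hlog, div_eq_mul_inv]; linarith
  have h3 : |Real.log y| ≤ 2 / √y + y := by
    rw [abs_le]; constructor
    · linarith
    · have : 0 < 2 / √y := by positivity
      linarith
  have h4 : y * (2 / √y) = 2 * √y := by
    field_simp; exact (Real.sq_sqrt hy).symm
  nlinarith

theorem IsLogConcave.integrable_mul_log {f : ℝ → ℝ} (hf : IsLogConcave f)
    (hi : Integrable f) (hpos : 0 < ∫ x, f x) : Integrable fun x => f x * Real.log (f x) := by
  refine (((hf.integrable_rpow hi hpos (q := 1 / 2) (by norm_num)).const_mul 2).add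
    (hf.integrable_rpow hi hpos (q := 2) (by norm_num))).mono'
    (hi.1.aemeasurable.mul (Real.measurable_log.comp_aemeasurable
      hi.1.aemeasurable)).aestronglyMeasurable ?_
  exact Filter.Eventually.of_forall fun x => abs_mul_log_le (hf.1 x)

/-! ### Brunn–Minkowski and Prékopa–Leindler on the line -/

-- The translates `K + inf L` and `sup K + L` both lie in `K + L` and overlap in at most one point.
open scoped Pointwise in
theorem IsCompact.volume_add_volume_le {K L : Set ℝ} (hK : IsCompact K) (hL : IsCompact L)
    (hK0 : K.Nonempty) (hL0 : L.Nonempty) : volume K + volume L ≤ volume (K + L) := by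
  have ha := hK.sSup_mem hK0
  have hb := hL.sInf_mem hL0
  set a := sSup K
  set b := sInf L
  have h1 : volume ((fun x => x + b) '' K) = volume K := by
    rw [Set.image_add_right, measure_preimage_add_right]
  have h2 : volume ((fun x => a + x) '' L) = volume L := by
    rw [Set.image_add_left, measure_preimage_add]
  have hd : AEDisjoint volume ((fun x => x + b) '' K) ((fun x => a + x) '' L) := by
    refine measure_mono_null (t := {a + b}) ?_ (by simp)
    rintro z ⟨⟨x, hx, rfl⟩, ⟨y, hy, hxy⟩⟩
    have h3 : x ≤ a := le_csSup hK.bddAbove hx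
    have h4 : b ≤ y := csInf_le hL.bddBelow hy
    simp only [Set.mem_singleton_iff] at hxy ⊢
    linarith
  have hm : NullMeasurableSet ((fun x => a + x) '' L) volume :=
    (hL.image (continuous_const_add a)).measurableSet.nullMeasurableSet
  rw [← h1, ← h2, ← measure_union₀ hm hd]
  refine measure_mono (Set.union_subset ?_ ?_)
  · rintro _ ⟨x, hx, rfl⟩
    exact Set.add_mem_add hx hb
  · rintro _ ⟨y, hy, rfl⟩
    exact Set.add_mem_add ha hy

open scoped Pointwise in
/-- The one-dimensional Brunn-Minkowski inequality. -/
theorem MeasurableSet.volume_add_volume_le {A B : Set ℝ} (hA : MeasurableSet A)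
    (hB : MeasurableSet B) (hA0 : A.Nonempty) (hB0 : B.Nonempty) :
    volume A + volume B ≤ volume (A + B) := by
  obtain ⟨a, ha⟩ := hA0
  obtain ⟨b, hb⟩ := hB0
  have hsup : ∀ {S : Set ℝ}, MeasurableSet S →
      volume S = ⨆ K, ⨆ (_ : K ⊆ S ∧ IsCompact K), volume K := by
    intro S hS
    rw [hS.measure_eq_iSup_isCompact]
    simp only [iSup_and]
  rw [hsup hA, hsup hB]
  refine ENNReal.biSup_add_biSup_le' ⟨∅, Set.empty_subset _, isCompact_empty⟩
    ⟨∅, Set.empty_subset _, isCompact_empty⟩ ?_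
  rintro K ⟨hKA, hK⟩ L ⟨hLB, hL⟩
  -- The approximating compact sets may be empty; adjoining `a` and `b` makes the compact case
  -- applicable.
  calc volume K + volume L ≤ volume (insert a K) + volume (insert b L) := by
        gcongr <;> exact Set.subset_insert _ _
    _ ≤ volume (insert a K + insert b L) :=
        (hK.insert a).volume_add_volume_le (hL.insert b) ⟨a, by simp⟩ ⟨b, by simp⟩
    _ ≤ volume (A + B) :=
        measure_mono (Set.add_subset_add (Set.insert_subset ha hKA) (Set.insert_subset hb hLB))

-- Layer-cake argument: `(1 - t){u > s} + t{v > s}` lies in `{h > s}`, so Brunn–Minkowski applies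
-- level by level. The common supremum `1` makes both level sets nonempty for `s < 1` and both empty
-- for `s ≥ 1`.
open scoped Pointwise in
theorem lintegral_add_lintegral_le_of_rpow_mul_rpow_le {u v h : ℝ → ℝ} (hu : ∀ x, 0 ≤ u x)
    (hv : ∀ x, 0 ≤ v x) (hh : ∀ x, 0 ≤ h x) (hum : Measurable u) (hvm : Measurable v)
    (hhm : Measurable h) {t : ℝ} (ht0 : 0 < t) (ht1 : t < 1)
    (huv : ∀ x y, u x ^ (1 - t) * v y ^ t ≤ h ((1 - t) * x + t * y))
    (hu1 : IsLUB (Set.range u) 1) (hv1 : IsLUB (Set.range v) 1) :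
    ENNReal.ofReal (1 - t) * (∫⁻ x, ENNReal.ofReal (u x)) +
      ENNReal.ofReal t * (∫⁻ x, ENNReal.ofReal (v x)) ≤ ∫⁻ x, ENNReal.ofReal (h x) := by
  have hms : ∀ {w : ℝ → ℝ}, Measurable w → Measurable fun s => volume {x | s < w x} := by
    intro w hw
    refine Antitone.measurable fun s s' hs => measure_mono fun x hx => ?_
    exact lt_of_le_of_lt hs hx
  rw [lintegral_eq_lintegral_meas_lt _ (Filter.Eventually.of_forall hu) hum.aemeasurable,
    lintegral_eq_lintegral_meas_lt _ (Filter.Eventually.of_forall hv) hvm.aemeasurable,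
    lintegral_eq_lintegral_meas_lt _ (Filter.Eventually.of_forall hh) hhm.aemeasurable,
    ← lintegral_const_mul _ (hms hum), ← lintegral_const_mul _ (hms hvm),
    ← lintegral_add_left ((hms hum).const_mul _)]
  refine setLIntegral_mono' measurableSet_Ioi fun s hs => ?_
  have hs0 : 0 < s := hs
  have ht1' : 0 < 1 - t := sub_pos.2 ht1
  rcases lt_or_ge s 1 with hs1 | hs1
  · obtain ⟨_, ⟨a, rfl⟩, ha, -⟩ := hu1.exists_between hs1
    obtain ⟨_, ⟨b, rfl⟩, hb, -⟩ := hv1.exists_between hs1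
    have hsm : ∀ {c : ℝ}, 0 < c → ∀ A : Set ℝ,
        ENNReal.ofReal c * volume A = volume (c • A) := by
      intro c hc A
      rw [Measure.addHaar_smul]; simp [abs_of_pos hc]
    rw [hsm ht1', hsm ht0]
    refine (MeasurableSet.volume_add_volume_le ?_ ?_ ?_ ?_).trans (measure_mono ?_)
    · exact (measurableSet_lt measurable_const hum).const_smul₀ _
    · exact (measurableSet_lt measurable_const hvm).const_smul₀ _
    · exact Set.Nonempty.smul_set ⟨a, ha⟩
    · exact Set.Nonempty.smul_set ⟨b, hb⟩
    · rintro _ ⟨_, ⟨x, hx, rfl⟩, _, ⟨y, hy, rfl⟩, rfl⟩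
      refine lt_of_lt_of_le ?_ (huv x y)
      calc s = s ^ (1 - t) * s ^ t := by rw [← Real.rpow_add hs0]; simp
        _ < u x ^ (1 - t) * v y ^ t := by
          have h1 : s ^ (1 - t) < u x ^ (1 - t) := Real.rpow_lt_rpow hs0.le hx ht1'
          have h2 : s ^ t < v y ^ t := Real.rpow_lt_rpow hs0.le hy ht0
          have h3 : 0 < s ^ (1 - t) := Real.rpow_pos_of_pos hs0 _
          have h4 : 0 < s ^ t := Real.rpow_pos_of_pos hs0 _
          exact mul_lt_mul'' h1 h2 h3.le h4.le
  · have h1 : {x | s < u x} = ∅ := by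
      ext x; simpa using (hu1.1 ⟨x, rfl⟩).trans hs1
    have h2 : {x | s < v x} = ∅ := by
      ext x; simpa using (hv1.1 ⟨x, rfl⟩).trans hs1
    simp [h1, h2]

/-- The one-dimensional Prékopa-Leindler inequality, for bounded functions. -/
theorem integral_rpow_mul_integral_rpow_le {u v h : ℝ → ℝ} (hu : ∀ x, 0 ≤ u x)
    (hv : ∀ x, 0 ≤ v x) (hh : ∀ x, 0 ≤ h x) (hum : Measurable u) (hvm : Measurable v)
    (hhm : Measurable h) (hui : Integrable u) (hvi : Integrable v) (hhi : Integrable h)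
    (hub : BddAbove (Set.range u)) (hvb : BddAbove (Set.range v))
    {t : ℝ} (ht0 : 0 < t) (ht1 : t < 1)
    (huv : ∀ x y, u x ^ (1 - t) * v y ^ t ≤ h ((1 - t) * x + t * y)) :
    (∫ x, u x) ^ (1 - t) * (∫ x, v x) ^ t ≤ ∫ x, h x := by
  have ht1' : 0 < 1 - t := sub_pos.2 ht1
  have hIu : 0 ≤ ∫ x, u x := integral_nonneg hu
  have hIv : 0 ≤ ∫ x, v x := integral_nonneg hv
  have hIh : 0 ≤ ∫ x, h x := integral_nonneg hh
  rcases hIu.eq_or_lt with h0 | hu0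
  · rwa [← h0, Real.zero_rpow ht1'.ne', zero_mul]
  rcases hIv.eq_or_lt with h0 | hv0
  · rwa [← h0, Real.zero_rpow ht0.ne', mul_zero]
  have hsup : ∀ {w : ℝ → ℝ}, (∀ x, 0 ≤ w x) → BddAbove (Set.range w) → 0 < ∫ x, w x →
      ∃ a, 0 < a ∧ IsLUB (Set.range fun x => w x / a) 1 := by
    intro w hw hwb hw0
    have hl := isLUB_csSup (Set.range_nonempty w) hwb
    obtain ⟨a, -, -, ha, -⟩ := exists_ne_pos_of_integral_pos hw hw0
    have hpos : 0 < sSup (Set.range w) := ha.trans_le (hl.1 ⟨a, rfl⟩)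
    refine ⟨_, hpos, ?_, ?_⟩
    · rintro _ ⟨x, rfl⟩
      exact (div_le_one hpos).2 (hl.1 ⟨x, rfl⟩)
    · intro c hc
      have : sSup (Set.range w) ≤ c * sSup (Set.range w) := by
        refine hl.2 ?_
        rintro _ ⟨x, rfl⟩
        exact (div_le_iff₀ hpos).1 (hc ⟨x, rfl⟩)
      nlinarith
  obtain ⟨a, ha, hal⟩ := hsup hu hub hu0
  obtain ⟨b, hb, hbl⟩ := hsup hv hvb hv0
  -- Dividing `u`, `v` by their suprema and `h` by `c` preserves the hypothesis `huv`.
  set c := a ^ (1 - t) * b ^ t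
  have hc : 0 < c := mul_pos (Real.rpow_pos_of_pos ha _) (Real.rpow_pos_of_pos hb _)
  have key := lintegral_add_lintegral_le_of_rpow_mul_rpow_le (u := fun x => u x / a)
    (v := fun x => v x / b) (h := fun x => h x / c) (fun x => div_nonneg (hu x) ha.le)
    (fun x => div_nonneg (hv x) hb.le) (fun x => div_nonneg (hh x) hc.le)
    (hum.div_const a) (hvm.div_const b) (hhm.div_const c) ht0 ht1 (fun x y => by
      rw [Real.div_rpow (hu x) ha.le, Real.div_rpow (hv y) hb.le, div_mul_div_comm]
      exact div_le_div_of_nonneg_right (huv x y) hc.le) hal hbl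
  rw [← ofReal_integral_eq_lintegral_ofReal (hui.div_const a)
      (Filter.Eventually.of_forall fun x => div_nonneg (hu x) ha.le),
    ← ofReal_integral_eq_lintegral_ofReal (hvi.div_const b)
      (Filter.Eventually.of_forall fun x => div_nonneg (hv x) hb.le),
    ← ofReal_integral_eq_lintegral_ofReal (hhi.div_const c)
      (Filter.Eventually.of_forall fun x => div_nonneg (hh x) hc.le),
    integral_div, integral_div, integral_div, ← ENNReal.ofReal_mul ht1'.le,
    ← ENNReal.ofReal_mul ht0.le, ← ENNReal.ofReal_add (by positivity) (by positivity),
    ENNReal.ofReal_le_ofReal_iff (by positivity)] at key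
  have amgm := Real.geom_mean_le_arith_mean2_weighted ht1'.le ht0.le
    (div_nonneg hIu ha.le) (div_nonneg hIv hb.le) (by ring)
  rw [Real.div_rpow hIu ha.le, Real.div_rpow hIv hb.le, div_mul_div_comm] at amgm
  exact (div_le_div_iff_of_pos_right hc).1 (amgm.trans key)

/-! ### Moment comparison with the exponential -/

/-- Integrate `(x ^ p - x₀ ^ p) * (g x - e x) ≤ 0`: the two factors have opposite signs on either
side of `x₀`. -/
theorem integral_Ioi_rpow_mul_le_of_single_crossing {g e : ℝ → ℝ} {p x₀ : ℝ} (hp : 0 ≤ p)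
    (hx₀ : 0 ≤ x₀) (hg0 : ∀ x, 0 ≤ g x) (he0 : ∀ x, 0 ≤ e x)
    (hg : IntegrableOn g (Set.Ioi 0)) (he : IntegrableOn e (Set.Ioi 0))
    (hep : IntegrableOn (fun x => x ^ p * e x) (Set.Ioi 0))
    (hle : ∫ x in Set.Ioi 0, g x ≤ ∫ x in Set.Ioi 0, e x)
    (h₁ : ∀ x, 0 < x → x < x₀ → e x ≤ g x) (h₂ : ∀ x, x₀ < x → g x ≤ e x) :
    IntegrableOn (fun x => x ^ p * g x) (Set.Ioi 0) ∧
      ∫ x in Set.Ioi 0, x ^ p * g x ≤ ∫ x in Set.Ioi 0, x ^ p * e x := by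
  have hgp : IntegrableOn (fun x => x ^ p * g x) (Set.Ioi 0) := by
    refine ((hg.const_mul (x₀ ^ p)).add hep).mono' ?_ ?_
    · exact (by fun_prop : AEStronglyMeasurable (fun x : ℝ => x ^ p)
        (volume.restrict (Set.Ioi 0))).mul hg.1
    · refine (ae_restrict_iff' measurableSet_Ioi).2 (Filter.Eventually.of_forall fun x hx => ?_)
      have hx0 : 0 < x := hx
      have hxp : 0 ≤ x ^ p := Real.rpow_nonneg hx0.le p
      have hxp0 : 0 ≤ x₀ ^ p := Real.rpow_nonneg hx₀ p
      rw [Real.norm_of_nonneg (mul_nonneg hxp (hg0 x))]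
      simp only [Pi.add_apply]
      rcases le_or_gt x x₀ with h | h
      · have h1 : x ^ p * g x ≤ x₀ ^ p * g x :=
          mul_le_mul_of_nonneg_right (Real.rpow_le_rpow hx0.le h hp) (hg0 x)
        have := mul_nonneg hxp (he0 x)
        linarith
      · have h1 : x ^ p * g x ≤ x ^ p * e x := mul_le_mul_of_nonneg_left (h₂ x h) hxp
        have := mul_nonneg hxp0 (hg0 x)
        linarith
  refine ⟨hgp, ?_⟩
  have key : ∫ x in Set.Ioi 0, (x ^ p * g x - x ^ p * e x) ≤
      ∫ x in Set.Ioi 0, (x₀ ^ p * g x - x₀ ^ p * e x) := by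
    refine setIntegral_mono_on (hgp.sub hep) ((hg.const_mul _).sub (he.const_mul _))
      measurableSet_Ioi fun x hx => ?_
    have hx0 : 0 < x := hx
    rcases lt_trichotomy x x₀ with h | h | h
    · have := Real.rpow_le_rpow hx0.le h.le hp
      nlinarith [h₁ x hx0 h]
    · rw [h]
    · have := Real.rpow_le_rpow hx₀ h.le hp
      nlinarith [h₂ x h]
  rw [integral_sub hgp hep, integral_sub (hg.const_mul _) (he.const_mul _),
    integral_const_mul, integral_const_mul] at key
  have := mul_le_mul_of_nonneg_left hle (Real.rpow_nonneg hx₀ p)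
  linarith

/-- Moments of a function on the half-line that is log-concave along segments from `0` are at
most those of the exponential function with the same value at `0` and the same integral. -/
theorem integral_Ioi_rpow_mul_le_of_logConcave_zero {g : ℝ → ℝ} {p c : ℝ} (hp : 0 ≤ p)
    (hc : 0 < c) (hg0 : ∀ x, 0 ≤ g x) (hg : IntegrableOn g (Set.Ioi 0)) (h0 : 0 < g 0)
    (hint : ∫ x in Set.Ioi 0, g x = g 0 / c)
    (hlc : ∀ z t, 0 < t → t < 1 → g 0 ^ (1 - t) * g z ^ t ≤ g (t * z)) :
    IntegrableOn (fun x => x ^ p * g x) (Set.Ioi 0) ∧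
      ∫ x in Set.Ioi 0, x ^ p * g x ≤ g 0 * (Real.Gamma (p + 1) / c ^ (p + 1)) := by
  set e : ℝ → ℝ := fun x => g 0 * Real.exp (-(c * x)) with he_def
  have he0 : ∀ x, 0 ≤ e x := fun x => mul_nonneg h0.le (Real.exp_pos _).le
  have hexp : ∀ q : ℝ, 0 ≤ q → IntegrableOn (fun x => x ^ q * e x) (Set.Ioi 0) := by
    intro q hq
    refine IntegrableOn.congr_fun ((integrableOn_rpow_mul_exp_neg_mul_rpow (s := q) (p := 1)
      (b := c) (by linarith) one_pos hc).const_mul (g 0)) ?_ measurableSet_Ioi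
    intro x hx
    simp only [Real.rpow_one, he_def, neg_mul]
    ring
  have hexp_int : ∀ q : ℝ, 0 ≤ q →
      ∫ x in Set.Ioi 0, x ^ q * e x = g 0 * (Real.Gamma (q + 1) / c ^ (q + 1)) := by
    intro q hq
    have := Real.integral_rpow_mul_exp_neg_mul_Ioi (a := q + 1) (by linarith) hc
    rw [Real.div_rpow zero_le_one hc.le, Real.one_rpow] at this
    rw [div_eq_inv_mul, ← one_div, ← this, ← integral_const_mul]
    congr 1 with x
    simp only [he_def, add_sub_cancel_right]
    ring
  have he : IntegrableOn e (Set.Ioi 0) := by simpa using hexp 0 le_rfl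
  have he_int : ∫ x in Set.Ioi 0, e x = g 0 / c := by
    have := hexp_int 0 le_rfl
    simpa [div_eq_mul_inv] using this
  -- `log e` is affine, `log g` is concave along segments from `0`, and they agree at `0`; so `g ≥
  -- e` at `z` propagates down to `(0, z)`. The set `S` below is therefore an initial interval, with
  -- the crossing point as its supremum.
  have hdown : ∀ z, e z ≤ g z → ∀ x, 0 < x → x < z → e x ≤ g x := by
    intro z hz x hx hxz
    have hz0 : 0 < z := hx.trans hxz
    have ht0 : 0 < x / z := div_pos hx hz0
    have h1 := hlc z (x / z) ht0 ((div_lt_one hz0).2 hxz)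
    rw [div_mul_cancel₀ _ hz0.ne'] at h1
    refine le_trans ?_ h1
    have h2 : e z ^ (x / z) ≤ g z ^ (x / z) := Real.rpow_le_rpow (he0 z) hz ht0.le
    have h3 : 0 < g 0 ^ (1 - x / z) := Real.rpow_pos_of_pos h0 _
    calc e x = g 0 ^ (1 - x / z) * e z ^ (x / z) := by
          simp only [he_def]
          rw [Real.mul_rpow h0.le (Real.exp_pos _).le, ← Real.exp_mul, ← mul_assoc,
            ← Real.rpow_add h0]
          have : -(c * z) * (x / z) = -(c * x) := by field_simp
          rw [this]; simp
      _ ≤ _ := by gcongr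
  rw [← hexp_int p hp]
  set S := {x : ℝ | 0 < x ∧ e x ≤ g x} with hS
  by_cases hb : BddAbove S
  · rcases S.eq_empty_or_nonempty with hSe | hSn
    · refine integral_Ioi_rpow_mul_le_of_single_crossing (x₀ := 0) hp le_rfl hg0 he0 hg he
        (hexp p hp) (hint.trans he_int.symm).le (fun x hx hx' => absurd hx' hx.not_gt) ?_
      intro x hx
      by_contra! hc'
      have : x ∈ S := ⟨hx, hc'.le⟩
      simp [hSe] at this
    · have hpos : 0 ≤ sSup S := by
        obtain ⟨y, hy⟩ := hSn
        exact hy.1.le.trans (le_csSup hb hy)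
      refine integral_Ioi_rpow_mul_le_of_single_crossing (x₀ := sSup S) hp hpos hg0 he0 hg he
        (hexp p hp) (hint.trans he_int.symm).le ?_ ?_
      · intro x hx hx'
        obtain ⟨z, hz, hxz⟩ := exists_lt_of_lt_csSup hSn hx'
        exact hdown z hz.2 x hx hxz
      · intro x hx
        by_contra! hc'
        exact hx.not_ge (le_csSup hb ⟨hpos.trans_lt hx, hc'.le⟩)
  -- Without a crossing `g ≥ e` throughout, and equal integrals force equality almost everywhere.
  · have hge : ∀ x ∈ Set.Ioi (0 : ℝ), e x ≤ g x := by
      intro x hx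
      obtain ⟨z, hz, hxz⟩ := not_bddAbove_iff.1 hb x
      exact hdown z hz.2 x hx hxz
    have hae : g - e =ᵐ[volume.restrict (Set.Ioi 0)] 0 := by
      refine (integral_eq_zero_iff_of_nonneg_ae ?_ (hg.sub he)).1 ?_
      · refine (ae_restrict_iff' measurableSet_Ioi).2 (Filter.Eventually.of_forall fun x hx => ?_)
        simpa using hge x hx
      · simp only [Pi.sub_apply]
        rw [integral_sub hg he, hint, he_int, sub_self]
    have hae' : (fun x => x ^ p * g x) =ᵐ[volume.restrict (Set.Ioi 0)] fun x => x ^ p * e x := by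
      filter_upwards [hae] with x hx
      have : g x = e x := by simpa [sub_eq_zero] using hx
      simp only [this]
    exact ⟨(hexp p hp).congr hae'.symm, (integral_congr_ae hae').le⟩

/-! ### The autocorrelation as density of the difference -/

theorem IsLogConcave.integrable_mul_comp_add {f : ℝ → ℝ} (hf : IsLogConcave f)
    (hfm : Measurable f) (hi : Integrable f) (hpos : 0 < ∫ x, f x) (z : ℝ) :
    Integrable fun x => f x * f (x + z) := by
  obtain ⟨M, hM⟩ := hf.exists_le hi hpos
  refine (hi.mul_const M).mono' (by fun_prop) (Filter.Eventually.of_forall fun x => ?_)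
  rw [Real.norm_of_nonneg (mul_nonneg (hf.1 _) (hf.1 _))]
  exact mul_le_mul_of_nonneg_left (hM _) (hf.1 _)

/-- Prékopa–Leindler for the products `f x * f (x + w)` and `f y * f (y + z)`; log-concavity of each
factor supplies its hypothesis. -/
theorem IsLogConcave.autocorrelation_rpow_mul_rpow_le {f : ℝ → ℝ} (hf : IsLogConcave f)
    (hfm : Measurable f) (hi : Integrable f) (hpos : 0 < ∫ x, f x) (w z : ℝ) {t : ℝ}
    (ht0 : 0 < t) (ht1 : t < 1) :
    (∫ x, f x * f (x + w)) ^ (1 - t) * (∫ x, f x * f (x + z)) ^ t ≤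
      ∫ x, f x * f (x + ((1 - t) * w + t * z)) := by
  obtain ⟨M, hM⟩ := hf.exists_le hi hpos
  have hb : ∀ v, BddAbove (Set.range fun x => f x * f (x + v)) := by
    intro v
    refine ⟨M * M, ?_⟩
    rintro _ ⟨x, rfl⟩
    exact mul_le_mul (hM _) (hM _) (hf.1 _) ((hf.1 x).trans (hM x))
  refine integral_rpow_mul_integral_rpow_le (fun x => mul_nonneg (hf.1 _) (hf.1 _))
    (fun x => mul_nonneg (hf.1 _) (hf.1 _)) (fun x => mul_nonneg (hf.1 _) (hf.1 _))
    (by fun_prop) (by fun_prop) (by fun_prop) (hf.integrable_mul_comp_add hfm hi hpos _)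
    (hf.integrable_mul_comp_add hfm hi hpos _) (hf.integrable_mul_comp_add hfm hi hpos _)
    (hb _) (hb _) ht0 ht1 fun x y => ?_
  have h1 := hf.2 x y t ⟨ht0.le, ht1.le⟩
  have h2 := hf.2 (x + w) (y + z) t ⟨ht0.le, ht1.le⟩
  simp only [smul_eq_mul] at h1 h2
  rw [show (1 - t) * (x + w) + t * (y + z) = (1 - t) * x + t * y + ((1 - t) * w + t * z) by ring]
    at h2
  rw [Real.mul_rpow (hf.1 _) (hf.1 _), Real.mul_rpow (hf.1 _) (hf.1 _)]
  calc _ = (f x ^ (1 - t) * f y ^ t) * (f (x + w) ^ (1 - t) * f (y + z) ^ t) := by ring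
    _ ≤ _ := mul_le_mul h1 h2 (mul_nonneg (Real.rpow_nonneg (hf.1 _) _)
      (Real.rpow_nonneg (hf.1 _) _)) (hf.1 _)

theorem autocorrelation_neg (f : ℝ → ℝ) (z : ℝ) :
    ∫ x, f x * f (x + -z) = ∫ x, f x * f (x + z) := by
  rw [← integral_add_right_eq_self _ z]
  congr 1 with x
  rw [add_neg_cancel_right, mul_comm]

theorem measurable_autocorrelation {f : ℝ → ℝ} (hfm : Measurable f) :
    Measurable fun z => ∫ x, f x * f (x + z) := by
  have : StronglyMeasurable (Function.uncurry fun z x => f x * f (x + z)) := by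
    apply Measurable.stronglyMeasurable
    simp only [Function.uncurry_def]
    fun_prop
  exact this.integral_prod_right.measurable

/-- Substituting `y = x + z` and applying Tonelli identifies the autocorrelation as the density of
`Y - X`. -/
theorem IsLogConcave.lintegral_lintegral_comp_sub {f : ℝ → ℝ} (hf : IsLogConcave f)
    (hfm : Measurable f) (hi : Integrable f) (hpos : 0 < ∫ x, f x) {φ : ℝ → ENNReal}
    (hφ : Measurable φ) :
    ∫⁻ x, ENNReal.ofReal (f x) * ∫⁻ y, ENNReal.ofReal (f y) * φ (y - x) =
      ∫⁻ z, ENNReal.ofReal (∫ x, f x * f (x + z)) * φ z := by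
  calc _ = ∫⁻ x, ∫⁻ z, ENNReal.ofReal (f x * f (x + z)) * φ z := by
        congr 1 with x
        rw [← lintegral_const_mul _ (by fun_prop), ← lintegral_add_left_eq_self _ x]
        congr 1 with z
        rw [add_sub_cancel_left, ENNReal.ofReal_mul (hf.1 x), mul_assoc]
    _ = ∫⁻ z, ∫⁻ x, ENNReal.ofReal (f x * f (x + z)) * φ z := by
        refine lintegral_lintegral_swap (Measurable.aemeasurable ?_)
        simp only [Function.uncurry_def]
        fun_prop
    _ = _ := by
        congr 1 with z
        rw [lintegral_mul_const _ (by fun_prop), ofReal_integral_eq_lintegral_ofReal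
          (hf.integrable_mul_comp_add hfm hi hpos z)
          (Filter.Eventually.of_forall fun x => mul_nonneg (hf.1 _) (hf.1 _))]

theorem integral_mul_self_pos {f : ℝ → ℝ} (hpos : 0 < ∫ x, f x)
    (hi : Integrable fun x => f x * f x) : 0 < ∫ x, f x * f x := by
  refine (integral_nonneg fun x => mul_self_nonneg (f x)).lt_of_ne' fun h => ?_
  have := (integral_eq_zero_iff_of_nonneg (fun x => mul_self_nonneg (f x)) hi).1 h
  have h0 : f =ᵐ[volume] 0 := by
    filter_upwards [this] with x hx
    simpa using hx
  rw [integral_congr_ae h0] at hpos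
  simp at hpos

/-- The moments of the difference of two independent copies of a log-concave random variable. -/
theorem IsLogConcave.lintegral_lintegral_abs_sub_rpow_le {f : ℝ → ℝ} (hf : IsLogConcave f)
    (hfm : Measurable f) (hi : Integrable f) (h1 : ∫ x, f x = 1) {p : ℝ} (hp : 0 ≤ p) :
    ∫⁻ x, ENNReal.ofReal (f x) * ∫⁻ y, ENNReal.ofReal (f y) * ENNReal.ofReal (|y - x| ^ p) ≤
      ENNReal.ofReal (Real.Gamma (p + 1) / (2 * ∫ x, f x * f x) ^ p) := by
  have hpos : 0 < ∫ x, f x := by rw [h1]; exact one_pos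
  rw [hf.lintegral_lintegral_comp_sub hfm hi hpos (φ := fun z => ENNReal.ofReal (|z| ^ p))
    (by fun_prop)]
  set g : ℝ → ℝ := fun z => ∫ x, f x * f (x + z) with hg_def
  have hg0 : ∀ z, 0 ≤ g z := fun z => integral_nonneg fun x => mul_nonneg (hf.1 _) (hf.1 _)
  have hgm : Measurable g := measurable_autocorrelation hfm
  have heven : ∀ z, g (-z) = g z := autocorrelation_neg f
  have habs : ∀ z, g |z| = g z := fun z => by
    rcases abs_choice z with h | h <;> rw [h]
    exact heven z
  have hlf : ∫⁻ x, ENNReal.ofReal (f x) = 1 := by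
    rw [← ofReal_integral_eq_lintegral_ofReal hi (Filter.Eventually.of_forall hf.1), h1,
      ENNReal.ofReal_one]
  have hlg : ∫⁻ z, ENNReal.ofReal (g z) = 1 := by
    have := hf.lintegral_lintegral_comp_sub hfm hi hpos (φ := fun _ => 1) measurable_const
    simp only [mul_one, hlf] at this
    exact this.symm
  have hgi : Integrable g := by
    refine ⟨hgm.aestronglyMeasurable, ?_⟩
    rw [hasFiniteIntegral_iff_ofReal (Filter.Eventually.of_forall hg0), hlg]
    exact ENNReal.one_lt_top
  have hgint : ∫ z, g z = 1 := by
    rw [integral_eq_lintegral_of_nonneg_ae (Filter.Eventually.of_forall hg0)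
      hgm.aestronglyMeasurable, hlg, ENNReal.toReal_one]
  have hg00 : g 0 = ∫ x, f x * f x := by simp only [hg_def, add_zero]
  have hg0pos : 0 < g 0 := by
    rw [hg00]
    refine integral_mul_self_pos hpos ?_
    simpa using hf.integrable_mul_comp_add hfm hi hpos 0
  -- The even density `g` has mass `1 / 2` on the half-line, so the comparison exponential has rate
  -- `2 * g 0`.
  have hhalf : ∫ z in Set.Ioi 0, g z = g 0 / (2 * g 0) := by
    have := integral_comp_abs (f := g)
    simp only [habs, hgint] at this
    field_simp
    linarith
  obtain ⟨hint, hle⟩ := integral_Ioi_rpow_mul_le_of_logConcave_zero hp (by positivity) hg0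
    hgi.integrableOn hg0pos hhalf fun z t ht0 ht1 => by
      have := hf.autocorrelation_rpow_mul_rpow_le hfm hi hpos 0 z ht0 ht1
      simpa only [hg_def, mul_zero, zero_add] using this
  have hint' : Integrable fun z => |z| ^ p * g z := by
    refine integrable_of_even_of_integrableOn_Ioi (fun z => by rw [abs_neg, heven]) ?_
    refine hint.congr_fun (fun z hz => ?_) measurableSet_Ioi
    simp only [abs_of_pos (Set.mem_Ioi.1 hz)]
  have hval : ∫ z, |z| ^ p * g z = 2 * ∫ z in Set.Ioi 0, z ^ p * g z := by
    rw [← integral_comp_abs (f := fun z => z ^ p * g z)]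
    simp only [habs]
  calc _ = ∫⁻ z, ENNReal.ofReal (|z| ^ p * g z) := by
        congr 1 with z
        rw [ENNReal.ofReal_mul (by positivity), mul_comm]
    _ = ENNReal.ofReal (∫ z, |z| ^ p * g z) :=
        (ofReal_integral_eq_lintegral_ofReal hint' (Filter.Eventually.of_forall fun z =>
          mul_nonneg (by positivity) (hg0 z))).symm
    _ ≤ _ := by
        refine ENNReal.ofReal_le_ofReal ?_
        rw [hval, ← hg00]
        refine (mul_le_mul_of_nonneg_left hle zero_le_two).trans_eq ?_
        rw [Real.rpow_add_one (by positivity)]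
        field_simp

/-! ### Entropy bound and passage from `Y - X` to `X - E X` -/

/-- The differential entropy is at least the Rényi entropy of order two. -/
theorem integral_mul_log_le_log_integral_mul_self {f : ℝ → ℝ} (hf : ∀ x, 0 ≤ f x)
    (hi : Integrable f) (h1 : ∫ x, f x = 1) (h2 : Integrable fun x => f x * f x)
    (hl : Integrable fun x => f x * Real.log (f x)) :
    ∫ x, f x * Real.log (f x) ≤ Real.log (∫ x, f x * f x) := by
  have hA := integral_mul_self_pos (by rw [h1]; exact one_pos) h2
  set A := ∫ x, f x * f x
  -- The tangent bound `log u ≤ u - 1` at `u = f x / A`; the right-hand side integrates to `log A`.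
  have key : ∫ x, f x * Real.log (f x) ≤ ∫ x, (f x * f x / A + f x * (Real.log A - 1)) := by
    refine integral_mono hl ((h2.div_const A).add (hi.mul_const _)) fun x => ?_
    rcases (hf x).eq_or_lt with h | h
    · simp [← h]
    · have := Real.log_le_sub_one_of_pos (div_pos h hA)
      rw [Real.log_div h.ne' hA.ne'] at this
      have := mul_le_mul_of_nonneg_left this h.le
      calc f x * Real.log (f x) ≤ f x * (f x / A - 1) + f x * Real.log A := by linarith
        _ = _ := by ring
  rw [integral_add (h2.div_const A) (hi.mul_const _), integral_div, integral_mul_const, h1,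
    div_self hA.ne'] at key
  linarith

/-- Jensen for the convex function `|y - x| ^ p` of `y`, at each fixed `x`. -/
theorem lintegral_abs_sub_integral_rpow_le {μ : Measure ℝ} [IsProbabilityMeasure μ] {p : ℝ}
    (hp : 1 ≤ p) (hμ : MemLp id (ENNReal.ofReal p) μ) :
    ∫⁻ x, ENNReal.ofReal (|x - ∫ y, y ∂μ| ^ p) ∂μ ≤
      ∫⁻ x, ∫⁻ y, ENNReal.ofReal (|y - x| ^ p) ∂μ ∂μ := by
  have hp0 : 0 < p := one_pos.trans_le hp
  have h1 : Integrable (fun y : ℝ => y) μ :=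
    hμ.integrable (by rw [← ENNReal.ofReal_one]; exact ENNReal.ofReal_le_ofReal hp)
  refine lintegral_mono fun x => ?_
  have hx : Integrable (fun y => |y - x| ^ p) μ := by
    have := (hμ.sub (memLp_const x)).integrable_norm_rpow (by simpa using hp0) (by simp)
    simpa [ENNReal.toReal_ofReal hp0.le] using this
  rw [← ofReal_integral_eq_lintegral_ofReal hx
    (Filter.Eventually.of_forall fun y => by positivity)]
  refine ENNReal.ofReal_le_ofReal ?_
  have hconv : ConvexOn ℝ Set.univ fun z : ℝ => |z| ^ p := by
    refine ⟨convex_univ, fun u _ v _ a b ha hb hab => ?_⟩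
    have h2 : |a • u + b • v| ≤ a • |u| + b • |v| := by
      refine (abs_add_le _ _).trans_eq ?_
      simp [abs_mul, abs_of_nonneg ha, abs_of_nonneg hb]
    exact (Real.rpow_le_rpow (abs_nonneg _) h2 hp0.le).trans
      ((convexOn_rpow hp).2 (abs_nonneg u) (abs_nonneg v) ha hb hab)
  have hcont : ContinuousOn (fun z : ℝ => |z| ^ p) Set.univ :=
    (continuous_abs.rpow_const fun _ => Or.inr hp0.le).continuousOn
  have := hconv.map_integral_le hcont isClosed_univ (f := fun y => y - x) (μ := μ) (by simp)
    (h1.sub (integrable_const x)) hx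
  rw [integral_sub h1 (integrable_const x)] at this
  simpa [abs_sub_comm] using this

/-- Expanding around the mean `m`, the inner integral is `V + (x - m) ^ 2`; integrating again gives
`2 * V`. -/
theorem lintegral_lintegral_abs_sub_rpow_two {μ : Measure ℝ} [IsProbabilityMeasure μ]
    (hμ : MemLp id 2 μ) :
    ∫⁻ x, ∫⁻ y, ENNReal.ofReal (|y - x| ^ (2 : ℝ)) ∂μ ∂μ =
      ENNReal.ofReal (2 * ∫ x, (x - ∫ y, y ∂μ) ^ 2 ∂μ) := by
  have h1 : Integrable (fun y : ℝ => y) μ := hμ.integrable (by norm_num)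
  set m := ∫ y, y ∂μ
  have hsq : ∀ c, Integrable (fun y => (y - c) ^ 2) μ := fun c =>
    (hμ.sub (memLp_const c)).integrable_sq
  set V := ∫ x, (x - m) ^ 2 ∂μ
  have hV : 0 ≤ V := integral_nonneg fun x => sq_nonneg _
  have hin : ∀ x, ∫ y, (y - x) ^ 2 ∂μ = V + (x - m) ^ 2 := by
    intro x
    have e : ∀ y, (y - x) ^ 2 = (y - m) ^ 2 + (2 * (m - x) * (y - m) + (x - m) ^ 2) := by
      intro y; ring
    simp only [e]
    have h2 : Integrable (fun y => 2 * (m - x) * (y - m)) μ :=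
      (h1.sub (integrable_const m)).const_mul _
    have h3 : Integrable (fun y => 2 * (m - x) * (y - m) + (x - m) ^ 2) μ :=
      h2.add (integrable_const _)
    rw [integral_add (hsq m) h3, integral_add h2 (integrable_const _), integral_const_mul,
      integral_sub h1 (integrable_const m)]
    simp [V, m]
  have hin' : ∀ x, ∫⁻ y, ENNReal.ofReal (|y - x| ^ (2 : ℝ)) ∂μ =
      ENNReal.ofReal (V + (x - m) ^ 2) := by
    intro x
    simp only [Real.rpow_two, sq_abs]
    rw [← ofReal_integral_eq_lintegral_ofReal (hsq x)
      (Filter.Eventually.of_forall fun y => sq_nonneg _), hin]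
  simp only [hin']
  have hadd : Integrable (fun x => V + (x - m) ^ 2) μ := (integrable_const V).add (hsq m)
  rw [← ofReal_integral_eq_lintegral_ofReal hadd
    (Filter.Eventually.of_forall fun y => by positivity),
    integral_add (integrable_const V) (hsq m)]
  congr 1
  simp [V]; ring

theorem IsLogConcave.memLp_id_withDensity {f : ℝ → ℝ} (hf : IsLogConcave f)
    (hfm : Measurable f) (hi : Integrable f) (hpos : 0 < ∫ x, f x) {p : ℝ} (hp : 0 < p) :
    MemLp id (ENNReal.ofReal p) (volume.withDensity fun x => ENNReal.ofReal (f x)) := by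
  rw [← integrable_norm_rpow_iff aestronglyMeasurable_id (by simpa using hp) (by simp),
    integrable_withDensity_iff (by fun_prop) (by simp)]
  simpa [ENNReal.toReal_ofReal hp.le, ENNReal.toReal_ofReal (hf.1 _)] using
    hf.integrable_abs_rpow_mul hi hpos hp.le

theorem lintegral_lintegral_withDensity {f : ℝ → ℝ} (hfm : Measurable f) {F : ℝ → ℝ → ENNReal}
    (hF : Measurable (Function.uncurry F)) :
    ∫⁻ x, ∫⁻ y, F x y ∂(volume.withDensity fun x => ENNReal.ofReal (f x))
        ∂(volume.withDensity fun x => ENNReal.ofReal (f x)) =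
      ∫⁻ x, ENNReal.ofReal (f x) * ∫⁻ y, ENNReal.ofReal (f y) * F x y := by
  have hin : ∀ x, ∫⁻ y, F x y ∂(volume.withDensity fun x => ENNReal.ofReal (f x)) =
      ∫⁻ y, ENNReal.ofReal (f y) * F x y := by
    intro x
    rw [lintegral_withDensity_eq_lintegral_mul _ (by fun_prop) (hF.of_uncurry_left)]
    rfl
  simp only [hin]
  rw [lintegral_withDensity_eq_lintegral_mul _ (by fun_prop)]
  · rfl
  · have hm : Measurable fun q : ℝ × ℝ => ENNReal.ofReal (f q.2) * F q.1 q.2 :=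
      (by fun_prop : Measurable fun q : ℝ × ℝ => ENNReal.ofReal (f q.2)).mul hF
    exact hm.lintegral_prod_right

/-- A law without atoms is not concentrated at `c`. Positivity keeps the arguments of the final
logarithms positive. -/
theorem integral_abs_sub_rpow_pos {μ : Measure ℝ} [IsProbabilityMeasure μ] (hμ : μ ≪ volume)
    {p : ℝ} (hp : 0 < p) (c : ℝ) (hi : Integrable (fun x => |x - c| ^ p) μ) :
    0 < ∫ x, |x - c| ^ p ∂μ := by
  have hnn : ∀ x : ℝ, 0 ≤ |x - c| ^ p := fun x => by positivity
  refine (integral_nonneg hnn).lt_of_ne' fun h => ?_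
  have h0 := (integral_eq_zero_iff_of_nonneg hnn hi).1 h
  have h1 : ∀ᵐ x ∂μ, x = c := by
    filter_upwards [h0] with x hx
    have : |x - c| = 0 := (Real.rpow_eq_zero (abs_nonneg _) hp.ne').1 hx
    linarith [abs_eq_zero.1 this]
  have h2 : ∀ᵐ x ∂μ, x ≠ c := hμ.ae_le (Measure.ae_ne volume c)
  obtain ⟨x, hx, hx'⟩ := (h1.and h2).exists
  exact hx' hx

/-! ### The entropy inequalities -/

theorem theorem3 {Ω : Type*} [MeasurableSpace Ω] (P : Measure Ω) [IsProbabilityMeasure P]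
    (X : Ω → ℝ) (hX : IsLogConcaveRV X P) :
    -- the entropy integral converges and the expectation of `X` exists
    Integrable (entropyIntegrand X P) volume ∧ Integrable X P ∧
    -- the bound for every `p ≥ 1`, the moment being finite
    (∀ p : ℝ, 1 ≤ p →
      Integrable (fun ω => |X ω - ∫ ω', X ω' ∂P| ^ p) P ∧
      Real.log (2 * momentNorm p (fun ω => X ω - ∫ ω', X ω' ∂P) P
          / Real.Gamma (p + 1) ^ (1 / p))
        ≤ differentialEntropy X P) ∧
    -- the sharper bound for `p = 2`
    Real.log (2 * Real.sqrt (variance X P)) ≤ differentialEntropy X P := by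
  obtain ⟨hXm, f, hfm, hf, hmap⟩ := hX
  set μ := (volume : Measure ℝ).withDensity (fun x => ENNReal.ofReal (f x)) with hμdef
  have hprob : IsProbabilityMeasure μ := hmap ▸ Measure.isProbabilityMeasure_map hXm
  have hac : μ ≪ volume := withDensity_absolutelyContinuous _ _
  have hlf : ∫⁻ x, ENNReal.ofReal (f x) = 1 := by
    have := hprob.measure_univ
    rwa [hμdef, withDensity_apply _ MeasurableSet.univ, Measure.restrict_univ] at this
  have hi : Integrable f := by
    refine ⟨hfm.aestronglyMeasurable, ?_⟩
    rw [hasFiniteIntegral_iff_ofReal (Filter.Eventually.of_forall hf.1), hlf]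
    exact ENNReal.one_lt_top
  have h1 : ∫ x, f x = 1 := by
    rw [integral_eq_lintegral_of_nonneg_ae (Filter.Eventually.of_forall hf.1)
      hfm.aestronglyMeasurable, hlf, ENNReal.toReal_one]
  have hpos : 0 < ∫ x, f x := by rw [h1]; exact one_pos
  have hent : entropyIntegrand X P =ᵐ[volume] fun x => -(f x * Real.log (f x)) := by
    have := hasPDF_of_map_eq_withDensity (μ := volume) hXm (fun x => ENNReal.ofReal (f x))
      (by fun_prop) hmap
    have hpdf := (pdf.eq_of_map_eq_withDensity (X := X) (μ := volume)
      (fun x => ENNReal.ofReal (f x)) (by fun_prop)).1 hmap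
    filter_upwards [hpdf] with x hx
    simp only [entropyIntegrand, hx, ENNReal.toReal_ofReal (hf.1 x)]
  have hlog := hf.integrable_mul_log hi hpos
  have hsq : Integrable fun x => f x * f x := by
    simpa using hf.integrable_mul_comp_add hfm hi hpos 0
  set A := ∫ x, f x * f x with hAdef
  have hA : 0 < A := integral_mul_self_pos hpos hsq
  have hbound : -Real.log A ≤ differentialEntropy X P := by
    rw [differentialEntropy, integral_congr_ae hent, integral_neg]
    exact neg_le_neg (integral_mul_log_le_log_integral_mul_self hf.1 hi h1 hsq hlog)
  -- Both inequalities now reduce to bounding a multiple of a moment norm by `1 / A`.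
  have hlogle : ∀ y, 0 < y → y ≤ 1 / A → Real.log y ≤ differentialEntropy X P := by
    intro y hy hyA
    refine (Real.log_le_log hy hyA).trans ?_
    rwa [one_div, Real.log_inv]
  have hmem : ∀ p : ℝ, 0 < p → MemLp id (ENNReal.ofReal p) μ := fun p hp =>
    hf.memLp_id_withDensity hfm hi hpos hp
  have hXi : Integrable X P := by
    have : Integrable id (P.map X) := by
      rw [hmap, ← memLp_one_iff_integrable]
      simpa using hmem 1 one_pos
    exact this.comp_aemeasurable hXm
  have hmean : ∫ ω, X ω ∂P = ∫ y, y ∂μ := by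
    rw [← hmap, integral_map hXm (by fun_prop)]
  rw [hmean]
  set m := ∫ y, y ∂μ with hm
  have hmom : ∀ p : ℝ, 0 < p → Integrable (fun x => |x - m| ^ p) μ := by
    intro p hp
    have := ((hmem p hp).sub (memLp_const m)).integrable_norm_rpow (by simpa using hp) (by simp)
    simpa [ENNReal.toReal_ofReal hp.le] using this
  have hdiff : ∀ p : ℝ, 0 ≤ p → ∫⁻ x, ∫⁻ y, ENNReal.ofReal (|y - x| ^ p) ∂μ ∂μ ≤
      ENNReal.ofReal (Real.Gamma (p + 1) / (2 * A) ^ p) := by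
    intro p hp
    rw [hμdef, lintegral_lintegral_withDensity hfm]
    · exact hf.lintegral_lintegral_abs_sub_rpow_le hfm hi h1 hp
    · simp only [Function.uncurry_def]
      fun_prop
  refine ⟨(integrable_congr hent).2 hlog.neg, hXi, fun p hp => ?_, ?_⟩
  · have hp0 : 0 < p := one_pos.trans_le hp
    have hG : 0 < Real.Gamma (p + 1) := Real.Gamma_pos_of_pos (by linarith)
    have hmeas : AEStronglyMeasurable (fun x : ℝ => |x - m| ^ p) (P.map X) :=
      (by fun_prop : Measurable fun x : ℝ => |x - m| ^ p).aestronglyMeasurable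
    have hint : Integrable (fun ω => |X ω - m| ^ p) P := by
      have : Integrable (fun x => |x - m| ^ p) (P.map X) := by rw [hmap]; exact hmom p hp0
      exact this.comp_aemeasurable hXm
    refine ⟨hint, ?_⟩
    have heq : ∫ ω, |X ω - m| ^ p ∂P = ∫ x, |x - m| ^ p ∂μ := by
      rw [← hmap, integral_map hXm hmeas]
    have hmpos := integral_abs_sub_rpow_pos hac hp0 m (hmom p hp0)
    have hle : ∫ x, |x - m| ^ p ∂μ ≤ Real.Gamma (p + 1) / (2 * A) ^ p := by
      have h2 := (lintegral_abs_sub_integral_rpow_le hp (hmem p hp0)).trans (hdiff p hp0.le)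
      rwa [← hm, ← ofReal_integral_eq_lintegral_ofReal (hmom p hp0)
        (Filter.Eventually.of_forall fun x => by positivity),
        ENNReal.ofReal_le_ofReal_iff (by positivity)] at h2
    rw [momentNorm, heq]
    have hGp : 0 < Real.Gamma (p + 1) ^ (1 / p) := Real.rpow_pos_of_pos hG _
    refine hlogle _ (by positivity) ?_
    have h3 : (∫ x, |x - m| ^ p ∂μ) ^ (1 / p) ≤ Real.Gamma (p + 1) ^ (1 / p) / (2 * A) := by
      refine (Real.rpow_le_rpow hmpos.le hle (by positivity)).trans_eq ?_
      rw [Real.div_rpow hG.le (by positivity), one_div, Real.rpow_rpow_inv (by positivity) hp0.ne']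
    rw [div_le_iff₀ hGp]
    calc _ ≤ 2 * (Real.Gamma (p + 1) ^ (1 / p) / (2 * A)) := by gcongr
      _ = _ := by field_simp
  · have hvar : variance X P = ∫ x, (x - m) ^ 2 ∂μ := by
      rw [variance_eq_integral hXm, hmean, ← hmap, integral_map hXm (by fun_prop)]
    have hmem2 : MemLp id 2 μ := by simpa using hmem 2 two_pos
    have hvpos : 0 < variance X P := by
      rw [hvar]
      simpa using integral_abs_sub_rpow_pos hac two_pos m (hmom 2 two_pos)
    -- The exact identity for the second moment of the difference keeps the factor `2` that Jensen
    -- would lose.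
    have hle : 2 * variance X P ≤ Real.Gamma (2 + 1) / (2 * A) ^ (2 : ℝ) := by
      have h2 := hdiff 2 zero_le_two
      rw [lintegral_lintegral_abs_sub_rpow_two hmem2, ← hm, ← hvar,
        ENNReal.ofReal_le_ofReal_iff (div_nonneg (Real.Gamma_nonneg_of_nonneg (by norm_num))
          (by positivity))] at h2
      exact h2
    have hG : Real.Gamma (2 + 1) = 2 := by
      rw [Real.Gamma_add_one two_ne_zero, Real.Gamma_two, mul_one]
    rw [hG, Real.rpow_two] at hle
    refine hlogle _ (by positivity) ?_
    have h3 : variance X P ≤ (1 / (2 * A)) ^ 2 := by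
      calc variance X P ≤ 2 / (2 * A) ^ 2 / 2 := by linarith
        _ = _ := by field_simp
    have h4 : √(variance X P) ≤ 1 / (2 * A) := (Real.sqrt_le_left (by positivity)).2 h3
    calc 2 * √(variance X P) ≤ 2 * (1 / (2 * A)) := by gcongr
      _ = 1 / A := by field_simp
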